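/- Let $n,m$ be natural numbers and let $\mathcal{D}=\{0,1\}^{n\times m}$ be the set of all $n\times m$ binary datasets. A tile $T=(t(T),a(T))$ consists of a set $t(T)\subseteq\{1,\dots,n\}$ of rows and a set $a(T)\subseteq\{1,\dots,m\}$ of columns; its entries are $\mathrm{area}(T)=t(T)\times a(T)$. The frequency of $T$ in a dataset $D$ is $$\mathrm{fr}(T;D)=\frac{1}{|\mathrm{area}(T)|}\sum_{(i,j)\in \mathrm{area}(T)}D(i,j)$$ (read as $0$ if $\mathrm{area}(T)=\emptyset$), and for a probability distribution $p$ on $\mathcal{D}$ we put $\mathrm{fr}(T;p)=\sum_{D\in\mathcal{D}}p(D)\,\mathrm{fr}(T;D)$. Let $\mathcal{T}$ be a finite set of tiles with prescribed real frequencies $(\alpha_T)_{T\in\mathcal{T}}$ that are consistent, i.e. the set $$\mathcal{P}=\{p \mid \mathrm{fr}(T;p)=\alpha_T \text{ for all } T\in\mathcal{T}\}$$ of probability distributions on $\mathcal{D}$ is non-empty. Let $\mathcal{Z}=\{D\in\mathcal{D}\mid p(D)=0 \text{ for all } p\in\mathcal{P}\}$, and for an entry $(i,j)$ let $\mathcal{T}(i,j)=\{T\in\mathcal{T}\mid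 (i,j)\in\mathrm{area}(T)\}$. Then there is exactly one $p^*\in\mathcal{P}$ of maximal entropy $H(p)=-\sum_{D}p(D)\log p(D)$ among all $p\in\mathcal{P}$. It is a product of independent Bernoulli entries: $$p^*(D)=\prod_{i,j}p^*\big((i,j)=D(i,j)\big)\qquad\text{for all } D\in\mathcal{D},$$ where $p^*((i,j)=v)$ is the probability that a dataset drawn from $p^*$ has the value $v$ at $(i,j)$. Moreover, there are real weights $(\lambda_T)_{T\in\mathcal{T}}$ such that $p^*$ has the exponential form $$p^*(D)\propto\exp\Big(\sum_{T\in\mathcal{T}}\lambda_T\,|\mathrm{area}(T)|\,\mathrm{fr}(T;D)\Big)\ \text{ for } D\notin\mathcal{Z},\qquad p^*(D)=0\ \text{ for } D\in\mathcal{Z},$$ with a positive constant of proportionality, and for every such family of weights and every entry $(i,j)$, either $$p^*((i,j)=1)=\frac{\exp\big(\sum_{T\in\mathcal{T}(i,j)}\lambda_T\big)}{\exp\big(\sum_{T\in\mathcal{T}(i,j)}\lambda_T\big)+1}$$ or $p^*((i,j)=1)\in\{0,1\}$. -/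

import Mathlib

namespace TileModel

/-- A binary dataset with `n` rows (transactions) and `m` columns (attributes). -/
abbrev Dataset (n m : ℕ) : Type := Fin n → Fin m → Bool

/-- A tile: a set of transactions together with a set of attributes. -/
structure Tile (n m : ℕ) where
  trans : Finset (Fin n)
  attr : Finset (Fin m)

variable {n m : ℕ}

/-- The entries of a tile, the Cartesian product of its transactions and its attributes. -/
def Tile.area (T : Tile n m) : Finset (Fin n × Fin m) := T.trans ×ˢ T.attr

/-- The frequency of a tile in a dataset, i.e. the proportion of ones among its entries
(`0` for a tile without entries). -/
noncomputable def freq (T : Tile n m) (D : Dataset n m) : ℝ :=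
  1 / (T.area.card : ℝ) * ∑ i ∈ T.trans, ∑ j ∈ T.attr, if D i j = true then (1 : ℝ) else 0

/-- The frequency of a tile with respect to a distribution `p` over datasets. -/
noncomputable def avgFreq (T : Tile n m) (p : Dataset n m → ℝ) : ℝ :=
  ∑ D, p D * freq T D

/-- The probability distributions over datasets that give each tile `T` of the tile set its
prescribed frequency `α T`. -/
def candidates (𝒯 : Finset (Tile n m)) (α : Tile n m → ℝ) : Set (Dataset n m → ℝ) :=
  {p | p ∈ stdSimplex ℝ (Dataset n m) ∧ ∀ T ∈ 𝒯, avgFreq T p = α T}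

/-- Shannon entropy `-∑ p(D) log p(D)`, with `0 log 0 = 0`. -/
noncomputable def entropy (p : Dataset n m → ℝ) : ℝ :=
  ∑ D, Real.negMulLog (p D)

/-- `p` is a maximum entropy distribution for the tile set and the frequencies. -/
def IsMaxEnt (𝒯 : Finset (Tile n m)) (α : Tile n m → ℝ) (p : Dataset n m → ℝ) : Prop :=
  p ∈ candidates 𝒯 α ∧ ∀ q ∈ candidates 𝒯 α, entropy q ≤ entropy p

/-- The probability `p((i, j) = v)` that a dataset drawn from `p` has `v` as its entry `(i, j)`. -/
noncomputable def cellProb (p : Dataset n m → ℝ) (i : Fin n) (j : Fin m) (v : Bool) : ℝ :=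
  ∑ D with D i j = v, p D

/-- The datasets that have probability zero under every candidate distribution. -/
def nullDatasets (𝒯 : Finset (Tile n m)) (α : Tile n m → ℝ) : Set (Dataset n m) :=
  {D | ∀ q ∈ candidates 𝒯 α, q D = 0}

/-- `w` is a family of exponential weights of `p`: outside the null datasets, `p(D)` is
proportional to `exp (∑ w_T |area T| freq(T; D))`, and `p` vanishes on the null datasets. -/
def HasWeights (𝒯 : Finset (Tile n m)) (α : Tile n m → ℝ) (p : Dataset n m → ℝ)
    (w : Tile n m → ℝ) : Prop :=
  ∃ c : ℝ, 0 < c ∧ ∀ D : Dataset n m,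
    (D ∉ nullDatasets 𝒯 α →
      p D = c * Real.exp (∑ T ∈ 𝒯, w T * (T.area.card : ℝ) * freq T D)) ∧
    (D ∈ nullDatasets 𝒯 α → p D = 0)

/-- The tiles of the tile set that cover the entry `(i, j)`. -/
def covering (𝒯 : Finset (Tile n m)) (i : Fin n) (j : Fin m) : Finset (Tile n m) :=
  {T ∈ 𝒯 | (i, j) ∈ T.area}

end TileModel

namespace TileModel

variable {n m : ℕ} {𝒯 : Finset (Tile n m)} {α : Tile n m → ℝ}

/-! ### Existence and uniqueness of the maximum entropy distribution -/

/-! Existence and uniqueness are compactness and strict concavity. Tile frequencies depend only on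
the marginals of the entries, so `indep p` satisfies the same constraints as `p`. Gibbs' inequality
shows that it has at least the entropy of `p`, and uniqueness makes the maximiser a product.

The maximiser is positive off the null datasets, because `negMulLog` has infinite slope at `0`
(`IsMaxEnt.pos_of_notMem`). Stationarity then says that `log p` annihilates every direction
supported there that preserves mass and frequencies, so by duality it is a combination of `1` and
the `freq T`. Switching one entry multiplies the exponential weight by `exp (∑ w_T)` over the
covering tiles, which fixes the odds of that entry. -/

lemma continuous_entropy : Continuous (entropy : (Dataset n m → ℝ) → ℝ) := by
  unfold entropy
  exact continuous_finsetSum _ fun D _ => Real.continuous_negMulLog.comp (continuous_apply D)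

lemma continuous_avgFreq (T : Tile n m) : Continuous (avgFreq T) := by
  unfold avgFreq
  fun_prop

lemma isCompact_candidates : IsCompact (candidates 𝒯 α) := by
  refine (isCompact_stdSimplex ℝ (Dataset n m)).inter_right
    (t := {p | ∀ T ∈ 𝒯, avgFreq T p = α T}) ?_
  simp only [Set.ofPred_forall]
  exact isClosed_iInter fun T => isClosed_iInter fun _ =>
    isClosed_eq (continuous_avgFreq T) continuous_const

lemma avgFreq_add_smul (T : Tile n m) (p v : Dataset n m → ℝ) (s t : ℝ) :
    avgFreq T (s • p + t • v) = s * avgFreq T p + t * avgFreq T v := by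
  simp only [avgFreq, Pi.add_apply, Pi.smul_apply, smul_eq_mul, Finset.mul_sum,
    ← Finset.sum_add_distrib]
  exact Finset.sum_congr rfl fun D _ => by ring

lemma convex_candidates : Convex ℝ (candidates 𝒯 α) := by
  intro p hp q hq a b ha hb hab
  refine ⟨convex_stdSimplex ℝ _ hp.1 hq.1 ha hb hab, fun T hT => ?_⟩
  rw [avgFreq_add_smul, hp.2 T hT, hq.2 T hT, ← add_mul, hab, one_mul]

lemma strictConcaveOn_entropy :
    StrictConcaveOn ℝ (stdSimplex ℝ (Dataset n m)) entropy := by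
  refine ⟨convex_stdSimplex ℝ _, fun p hp q hq hpq a b ha hb hab => ?_⟩
  obtain ⟨D₀, hD₀⟩ := Function.ne_iff.mp hpq
  simp only [entropy, smul_eq_mul, Finset.mul_sum, ← Finset.sum_add_distrib]
  refine Finset.sum_lt_sum (fun D _ => ?_) ⟨D₀, Finset.mem_univ _, ?_⟩
  · exact Real.concaveOn_negMulLog.2 (hp.1 D) (hq.1 D) ha.le hb.le hab
  · exact Real.strictConcaveOn_negMulLog.2 (hp.1 D₀) (hq.1 D₀) hD₀ ha hb hab

lemma IsMaxEnt.eq {p q : Dataset n m → ℝ} (hp : IsMaxEnt 𝒯 α p) (hq : IsMaxEnt 𝒯 α q) :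
    p = q :=
  (strictConcaveOn_entropy.subset (fun _ h => h.1) convex_candidates).eq_of_isMaxOn
    (fun r hr => hp.2 r hr) (fun r hr => hq.2 r hr) hp.1 hq.1

lemma existsUnique_isMaxEnt (hcons : (candidates 𝒯 α).Nonempty) :
    ∃! p : Dataset n m → ℝ, IsMaxEnt 𝒯 α p := by
  obtain ⟨p, hp, hmax⟩ :=
    isCompact_candidates.exists_isMaxOn hcons continuous_entropy.continuousOn
  exact ⟨p, ⟨hp, fun q hq => hmax hq⟩, fun q hq => hq.eq ⟨hp, fun q hq => hmax hq⟩⟩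

/-! ### Independence of the entries -/

lemma sum_prod_prod (f : Fin n → Fin m → Bool → ℝ) :
    ∑ D : Dataset n m, ∏ i, ∏ j, f i j (D i j) = ∏ i, ∏ j, ∑ v, f i j v := by
  have row (i : Fin n) : ∏ j, ∑ v, f i j v = ∑ r : Fin m → Bool, ∏ j, f i j (r j) := by
    rw [Finset.prod_univ_sum, Fintype.piFinset_univ]
  simp_rw [row]
  rw [Finset.prod_univ_sum, Fintype.piFinset_univ]

lemma cellProb_nonneg {p : Dataset n m → ℝ} (hp : p ∈ stdSimplex ℝ (Dataset n m))
    (i : Fin n) (j : Fin m) (v : Bool) : 0 ≤ cellProb p i j v :=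
  Finset.sum_nonneg fun D _ => hp.1 D

lemma le_cellProb {p : Dataset n m → ℝ} (hp : p ∈ stdSimplex ℝ (Dataset n m))
    (i : Fin n) (j : Fin m) (D : Dataset n m) : p D ≤ cellProb p i j (D i j) :=
  Finset.single_le_sum (f := p) (fun D _ => hp.1 D) (by simp)

lemma sum_mul_cell (p : Dataset n m → ℝ) (i : Fin n) (j : Fin m) (g : Bool → ℝ) :
    ∑ D, p D * g (D i j) = ∑ v, cellProb p i j v * g v := by
  rw [← Finset.sum_fiberwise (s := Finset.univ) (g := fun D : Dataset n m => D i j)]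
  refine Finset.sum_congr rfl fun v _ => ?_
  rw [cellProb, Finset.sum_mul]
  exact Finset.sum_congr rfl fun D hD => by rw [(Finset.mem_filter.mp hD).2]

lemma sum_cellProb {p : Dataset n m → ℝ} (hp : p ∈ stdSimplex ℝ (Dataset n m))
    (i : Fin n) (j : Fin m) : ∑ v, cellProb p i j v = 1 := by
  simpa [hp.2] using (sum_mul_cell p i j fun _ => 1).symm

/-- The distribution with independent entries that has the same marginals as `p`. -/
noncomputable def indep (p : Dataset n m → ℝ) (D : Dataset n m) : ℝ :=
  ∏ i, ∏ j, cellProb p i j (D i j)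

lemma indep_mem_stdSimplex {p : Dataset n m → ℝ} (hp : p ∈ stdSimplex ℝ (Dataset n m)) :
    indep p ∈ stdSimplex ℝ (Dataset n m) := by
  refine ⟨fun D => Finset.prod_nonneg fun i _ => Finset.prod_nonneg fun j _ =>
    cellProb_nonneg hp i j _, ?_⟩
  simp only [indep, sum_prod_prod, sum_cellProb hp, Finset.prod_const_one]

lemma cellProb_indep {p : Dataset n m → ℝ} (hp : p ∈ stdSimplex ℝ (Dataset n m))
    (i : Fin n) (j : Fin m) (v : Bool) : cellProb (indep p) i j v = cellProb p i j v := by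
  -- The event `D i j = v` is encoded as a factor at the single entry `(i, j)`, so the sum still
  -- factorises.
  let f : Fin n → Fin m → Bool → ℝ := fun i' j' v' =>
    cellProb p i' j' v' * if i' = i then if j' = j then if v' = v then 1 else 0 else 1 else 1
  have hf (D : Dataset n m) :
      ∏ i', ∏ j', f i' j' (D i' j') = if D i j = v then indep p D else 0 := by
    simp only [f, indep, Finset.prod_mul_distrib]
    have : ∏ i', ∏ j', (if i' = i then if j' = j then if D i' j' = v then (1 : ℝ) else 0 else 1
        else 1) = if D i j = v then 1 else 0 := by
      rw [Finset.prod_eq_single i (fun i' _ h => by simp [h]) (by simp),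
        Finset.prod_eq_single j (fun j' _ h => by simp [h]) (by simp)]
      simp
    rw [this, mul_ite, mul_one, mul_zero]
  have hs (i' : Fin n) (j' : Fin m) :
      ∑ v', f i' j' v' = if i' = i then if j' = j then cellProb p i j v else 1 else 1 := by
    by_cases hi : i' = i
    · by_cases hj : j' = j
      · subst hi hj
        simp [f]
      · simp only [f, hi, hj, if_true, if_false, mul_one, sum_cellProb hp]
    · simp only [f, hi, if_false, mul_one, sum_cellProb hp]
  rw [cellProb, Finset.sum_filter]
  simp_rw [← hf]
  rw [sum_prod_prod]
  simp_rw [hs]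
  rw [Finset.prod_eq_single i (fun i' _ h => by simp [h]) (by simp),
    Finset.prod_eq_single j (fun j' _ h => by simp [h]) (by simp)]
  simp

lemma avgFreq_eq_cellProb (T : Tile n m) (p : Dataset n m → ℝ) :
    avgFreq T p =
      1 / (T.area.card : ℝ) * ∑ i ∈ T.trans, ∑ j ∈ T.attr, cellProb p i j true := by
  have h (i : Fin n) (j : Fin m) :
      cellProb p i j true = ∑ D, p D * if D i j = true then (1 : ℝ) else 0 := by
    rw [sum_mul_cell p i j fun v => if v = true then (1 : ℝ) else 0]
    simp
  simp_rw [h, avgFreq, freq, Finset.mul_sum]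
  rw [Finset.sum_comm]
  refine Finset.sum_congr rfl fun i _ => ?_
  rw [Finset.sum_comm]
  exact Finset.sum_congr rfl fun j _ => Finset.sum_congr rfl fun D _ => by ring

lemma indep_mem_candidates {p : Dataset n m → ℝ} (hp : p ∈ candidates 𝒯 α) :
    indep p ∈ candidates 𝒯 α := by
  refine ⟨indep_mem_stdSimplex hp.1, fun T hT => ?_⟩
  rw [← hp.2 T hT, avgFreq_eq_cellProb, avgFreq_eq_cellProb]
  simp_rw [cellProb_indep hp.1]

lemma cellProb_pos_of_pos {p : Dataset n m → ℝ} (hp : p ∈ stdSimplex ℝ (Dataset n m))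
    {D : Dataset n m} (hD : 0 < p D) (i : Fin n) (j : Fin m) : 0 < cellProb p i j (D i j) :=
  hD.trans_le (le_cellProb hp i j D)

/-- The log of a product is a sum of one-entry functions, so its mean sees only marginals. Taking `q
= p` and `q = indep p` identifies the cross entropy with `entropy (indep p)`. -/
lemma sum_mul_log_indep {p q : Dataset n m → ℝ} (hq : q ∈ stdSimplex ℝ (Dataset n m))
    (h : ∀ i j v, cellProb q i j v = cellProb p i j v) :
    ∑ D, q D * Real.log (indep p D) =
      ∑ i, ∑ j, ∑ v, cellProb p i j v * Real.log (cellProb p i j v) := by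
  have key (D : Dataset n m) :
      q D * Real.log (indep p D) = ∑ i, ∑ j, q D * Real.log (cellProb p i j (D i j)) := by
    rcases (hq.1 D).eq_or_lt with h0 | h0
    · simp [← h0]
    · have hne (i : Fin n) (j : Fin m) : cellProb p i j (D i j) ≠ 0 := by
        rw [← h]
        exact (cellProb_pos_of_pos hq h0 i j).ne'
      rw [indep, Real.log_prod fun i _ => Finset.prod_ne_zero_iff.mpr fun j _ => hne i j,
        Finset.mul_sum]
      refine Finset.sum_congr rfl fun i _ => ?_
      rw [Real.log_prod fun j _ => hne i j, Finset.mul_sum]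
  simp_rw [key]
  rw [Finset.sum_comm]
  refine Finset.sum_congr rfl fun i _ => ?_
  rw [Finset.sum_comm]
  refine Finset.sum_congr rfl fun j _ => ?_
  rw [sum_mul_cell q i j fun v => Real.log (cellProb p i j v)]
  simp_rw [h]

/-- Gibbs' inequality. -/
lemma entropy_le_cross {p q : Dataset n m → ℝ} (hp : p ∈ stdSimplex ℝ (Dataset n m))
    (hq : q ∈ stdSimplex ℝ (Dataset n m)) (h : ∀ D, 0 < p D → 0 < q D) :
    entropy p ≤ -∑ D, p D * Real.log (q D) := by
  -- The correction `q D - p D` sums to zero.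
  have key (D : Dataset n m) :
      Real.negMulLog (p D) ≤ -(p D * Real.log (q D)) + (q D - p D) := by
    rcases (hp.1 D).eq_or_lt with h0 | h0
    · simpa [← h0] using hq.1 D
    · have h1 := Real.log_le_sub_one_of_pos (div_pos (h D h0) h0)
      rw [Real.log_div (h D h0).ne' h0.ne'] at h1
      have h2 := mul_le_mul_of_nonneg_left h1 h0.le
      have h3 : p D * (q D / p D - 1) = q D - p D := by field_simp
      rw [Real.negMulLog]
      linarith
  calc entropy p ≤ ∑ D, (-(p D * Real.log (q D)) + (q D - p D)) :=
        Finset.sum_le_sum fun D _ => key D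
    _ = -∑ D, p D * Real.log (q D) := by
        rw [Finset.sum_add_distrib, Finset.sum_sub_distrib, hp.2, hq.2, Finset.sum_neg_distrib]
        ring

lemma entropy_le_entropy_indep {p : Dataset n m → ℝ} (hp : p ∈ stdSimplex ℝ (Dataset n m)) :
    entropy p ≤ entropy (indep p) := by
  have hq := indep_mem_stdSimplex hp
  refine (entropy_le_cross hp hq fun D hD => Finset.prod_pos fun i _ =>
    Finset.prod_pos fun j _ => cellProb_pos_of_pos hp hD i j).trans_eq ?_
  rw [sum_mul_log_indep hp fun _ _ _ => rfl,
    ← sum_mul_log_indep hq (cellProb_indep hp), ← Finset.sum_neg_distrib, entropy]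
  simp_rw [Real.negMulLog, neg_mul]

lemma IsMaxEnt.eq_indep {p : Dataset n m → ℝ} (hp : IsMaxEnt 𝒯 α p) : p = indep p :=
  hp.eq ⟨indep_mem_candidates hp.1, fun q hq =>
    (hp.2 q hq).trans (entropy_le_entropy_indep hp.1.1)⟩

/-! ### The exponential form -/

lemma IsMaxEnt.pos_of_notMem {p : Dataset n m → ℝ} (hp : IsMaxEnt 𝒯 α p) {D : Dataset n m}
    (hD : D ∉ nullDatasets 𝒯 α) : 0 < p D := by
  simp only [nullDatasets, Set.mem_ofPred_eq, not_forall] at hD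
  obtain ⟨q, hq, hqD⟩ := hD
  have hqpos : 0 < q D := (hq.1.1 D).lt_of_ne' hqD
  refine (hp.1.1.1 D).lt_of_ne' fun h0 => ?_
  -- Moving mass `t * q D` onto `D` gains an extra `t * x * q D` when `t = exp (-x)`. This `x` makes
  -- the mixture's entropy at least `entropy p + t`.
  set x := (entropy p - entropy q + 1) / q D
  have hx : 0 < x := div_pos (by linarith [hp.2 q hq]) hqpos
  set t := Real.exp (-x) with ht
  have ht0 : 0 < t := Real.exp_pos _
  have ht1 : t < 1 := Real.exp_zero ▸ Real.exp_lt_exp.mpr (neg_lt_zero.mpr hx)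
  have hmax := hp.2 _ (convex_candidates hp.1 hq (sub_nonneg.mpr ht1.le) ht0.le
    (sub_add_cancel 1 t))
  have key (E : Dataset n m) : (1 - t) * Real.negMulLog (p E) + t * Real.negMulLog (q E) +
      (if E = D then t * (x * q D) else 0) ≤
        Real.negMulLog (((1 - t) • p + t • q) E) := by
    split_ifs with hE
    · subst hE
      simp only [Pi.add_apply, Pi.smul_apply, h0, smul_eq_mul, mul_zero, zero_add,
        Real.negMulLog_zero, Real.negMulLog_mul]
      rw [ht, Real.negMulLog.eq_1 (Real.exp _), Real.log_exp]
      exact le_of_eq (by ring)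
    · simpa using Real.concaveOn_negMulLog.2 (hp.1.1.1 E) (hq.1.1 E) (sub_nonneg.mpr ht1.le)
        ht0.le (sub_add_cancel 1 t)
  have hsum := Finset.sum_le_sum fun E (_ : E ∈ Finset.univ) => key E
  rw [Finset.sum_add_distrib, Finset.sum_add_distrib, ← Finset.mul_sum, ← Finset.mul_sum,
    Finset.sum_ite_eq' Finset.univ D, if_pos (Finset.mem_univ _)] at hsum
  change (1 - t) * entropy p + t * entropy q + _ ≤ entropy _ at hsum
  have hxq : x * q D = entropy p - entropy q + 1 := div_mul_cancel₀ _ hqD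
  rw [hxq] at hsum
  nlinarith

/-- The first order condition at a maximum entropy distribution. -/
lemma IsMaxEnt.sum_mul_log_eq_zero {p : Dataset n m → ℝ} (hp : IsMaxEnt 𝒯 α p)
    {v : Dataset n m → ℝ} (hv : ∀ D ∈ nullDatasets 𝒯 α, v D = 0) (hsum : ∑ D, v D = 0)
    (hfreq : ∀ T ∈ 𝒯, avgFreq T v = 0) : ∑ D, v D * Real.log (p D) = 0 := by
  have hnonneg : ∀ᶠ t : ℝ in nhds 0, ∀ D, 0 ≤ p D + t * v D := by
    refine Filter.eventually_all.mpr fun D => ?_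
    by_cases hD : D ∈ nullDatasets 𝒯 α
    · simp [hv D hD, hp.1.1.1 D]
    · have : Filter.Tendsto (fun t : ℝ => p D + t * v D) (nhds 0) (nhds (p D)) := by
        have hc : Continuous fun t : ℝ => p D + t * v D := by fun_prop
        simpa using hc.tendsto 0
      exact (this.eventually (lt_mem_nhds (hp.pos_of_notMem hD))).mono fun _ h => h.le
  have hmax : IsLocalMax (fun t : ℝ => ∑ D, Real.negMulLog (p D + t * v D)) 0 := by
    filter_upwards [hnonneg] with t ht
    have hc : (1 : ℝ) • p + t • v ∈ candidates 𝒯 α := by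
      refine ⟨⟨fun D => by simpa using ht D, ?_⟩, fun T hT => ?_⟩
      · simp [Finset.sum_add_distrib, ← Finset.mul_sum, hsum, hp.1.1.2]
      · rw [avgFreq_add_smul, hfreq T hT, hp.1.2 T hT, one_mul, mul_zero, add_zero]
    simpa [entropy] using hp.2 _ hc
  have hderiv : HasDerivAt (fun t : ℝ => ∑ D, Real.negMulLog (p D + t * v D))
      (∑ D, (-Real.log (p D) - 1) * v D) 0 := by
    refine HasDerivAt.fun_sum fun D _ => ?_
    -- On null datasets `p D = 0`, where `negMulLog` is not differentiable, but there `v D = 0` and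
    -- the term is constant.
    by_cases hD : D ∈ nullDatasets 𝒯 α
    · simpa [hv D hD] using hasDerivAt_const (0 : ℝ) (Real.negMulLog (p D))
    · have h1 : HasDerivAt (fun t : ℝ => p D + t * v D) (v D) 0 := by
        simpa using ((hasDerivAt_id (0 : ℝ)).mul_const (v D)).const_add (p D)
      have h2 : HasDerivAt Real.negMulLog (-Real.log (p D) - 1) (p D + 0 * v D) := by
        simpa using Real.hasDerivAt_negMulLog (hp.pos_of_notMem hD).ne'
      exact h2.comp 0 h1
  have h := hmax.hasDerivAt_eq_zero hderiv
  have hsplit : ∑ D, (-Real.log (p D) - 1) * v D = -∑ D, v D * Real.log (p D) - ∑ D, v D := by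
    rw [← Finset.sum_neg_distrib, ← Finset.sum_sub_distrib]
    exact Finset.sum_congr rfl fun D _ => by ring
  rw [hsplit, hsum] at h
  linarith

open Classical in
/-- The functional `v ↦ ∑ v(D) g(D)`, the sum running over the datasets outside `Z`. -/
noncomputable def pairingOff (Z : Set (Dataset n m)) (g : Dataset n m → ℝ) :
    (Dataset n m → ℝ) →ₗ[ℝ] ℝ :=
  ∑ D, (if D ∈ Z then 0 else g D) • LinearMap.proj D

open Classical in
lemma pairingOff_apply (Z : Set (Dataset n m)) (g v : Dataset n m → ℝ) :
    pairingOff Z g v = ∑ D, (if D ∈ Z then 0 else v D) * g D := by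
  simp only [pairingOff, LinearMap.sum_apply, LinearMap.smul_apply, LinearMap.proj_apply,
    smul_eq_mul]
  exact Finset.sum_congr rfl fun D _ => by split_ifs <;> ring

lemma pairingOff_single (Z : Set (Dataset n m)) (g : Dataset n m → ℝ) {D : Dataset n m}
    (hD : D ∉ Z) : pairingOff Z g (Pi.single D 1) = g D := by
  classical
  rw [pairingOff_apply, Finset.sum_eq_single D (fun E _ hE => by simp [hE]) (by simp)]
  simp [hD]

lemma IsMaxEnt.exists_hasWeights {p : Dataset n m → ℝ} (hp : IsMaxEnt 𝒯 α p) :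
    ∃ w : Tile n m → ℝ, HasWeights 𝒯 α p w := by
  classical
  set Z := nullDatasets 𝒯 α
  let L : Option 𝒯 → (Dataset n m → ℝ) →ₗ[ℝ] ℝ := fun o =>
    pairingOff Z (o.elim (fun _ => 1) fun T => freq T.1)
  have hmem : pairingOff Z (fun D => Real.log (p D)) ∈ Submodule.span ℝ (Set.range L) := by
    -- The first order condition is applied to `v` cut off to zero on `Z`.
    refine mem_span_of_iInf_ker_le_ker fun v hv => ?_
    rw [Submodule.mem_iInf] at hv
    have hL (o : Option 𝒯) : L o v = 0 := hv o
    rw [LinearMap.mem_ker, pairingOff_apply]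
    refine hp.sum_mul_log_eq_zero (fun D hD => if_pos hD) ?_ fun T hT => ?_
    · simpa [L, pairingOff_apply] using hL none
    · simpa [L, pairingOff_apply, avgFreq] using hL (some ⟨T, hT⟩)
  obtain ⟨μ, hμ⟩ := (Submodule.mem_span_range_iff_exists_fun ℝ).mp hmem
  -- The area is divided out because `HasWeights` multiplies by it; for an empty tile both sides are
  -- `0`. The coefficient of the constant function gives the normalisation.
  refine ⟨fun T => (if h : T ∈ 𝒯 then μ (some ⟨T, h⟩) else 0) / T.area.card,
    Real.exp (μ none), Real.exp_pos _, fun D => ⟨fun hD => ?_, fun hD => hD p hp.1⟩⟩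
  have h := LinearMap.congr_fun hμ (Pi.single D 1)
  rw [pairingOff_single Z _ hD, Fintype.sum_option] at h
  simp only [LinearMap.add_apply, LinearMap.sum_apply, LinearMap.smul_apply, L,
    pairingOff_single Z _ hD, smul_eq_mul, Option.elim_none, Option.elim_some, mul_one] at h
  rw [← Real.exp_add, ← Real.exp_log (hp.pos_of_notMem hD), ← h,
    ← Finset.sum_coe_sort 𝒯]
  congr 2
  refine Finset.sum_congr rfl fun T _ => ?_
  simp only [T.2, dite_true]
  by_cases hc : (T.1.area.card : ℝ) = 0
  · simp [freq, hc]
  · rw [div_mul_cancel₀ _ hc]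

/-! ### The marginals -/

lemma card_mul_freq (T : Tile n m) (D : Dataset n m) :
    (T.area.card : ℝ) * freq T D = ∑ x ∈ T.area, if D x.1 x.2 = true then (1 : ℝ) else 0 := by
  rw [freq, Tile.area, Finset.sum_product, ← mul_assoc]
  by_cases hc : ((T.trans ×ˢ T.attr).card : ℝ) = 0
  · rw [← Finset.sum_product (f := fun x : Fin n × Fin m =>
      if D x.1 x.2 = true then (1 : ℝ) else 0),
      Finset.card_eq_zero.mp (Nat.cast_eq_zero.mp hc)]
    simp
  · rw [mul_one_div_cancel hc, one_mul]

/-- The dataset `D` with its entry `(i, j)` replaced by `v`. -/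
def setEntry (D : Dataset n m) (i : Fin n) (j : Fin m) (v : Bool) : Dataset n m :=
  fun i' j' => if (i', j') = (i, j) then v else D i' j'

lemma card_mul_freq_setEntry (T : Tile n m) (D : Dataset n m) (i : Fin n) (j : Fin m) :
    (T.area.card : ℝ) * freq T (setEntry D i j true) =
      (T.area.card : ℝ) * freq T (setEntry D i j false) + if (i, j) ∈ T.area then 1 else 0 := by
  rw [card_mul_freq, card_mul_freq, ← Finset.sum_ite_eq' T.area (i, j) fun _ => (1 : ℝ),
    ← Finset.sum_add_distrib]
  refine Finset.sum_congr rfl fun x _ => ?_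
  by_cases hx : x = (i, j) <;> simp [setEntry, hx]

lemma weight_setEntry (w : Tile n m → ℝ) (D : Dataset n m) (i : Fin n) (j : Fin m) :
    ∑ T ∈ 𝒯, w T * (T.area.card : ℝ) * freq T (setEntry D i j true) =
      ∑ T ∈ 𝒯, w T * (T.area.card : ℝ) * freq T (setEntry D i j false) +
        ∑ T ∈ covering 𝒯 i j, w T := by
  rw [covering, Finset.sum_filter, ← Finset.sum_add_distrib]
  refine Finset.sum_congr rfl fun T _ => ?_
  rw [mul_assoc, card_mul_freq_setEntry, mul_add, mul_assoc, mul_ite, mul_one, mul_zero]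

lemma indep_setEntry (p : Dataset n m → ℝ) (D : Dataset n m) (i : Fin n) (j : Fin m) (v : Bool) :
    indep p (setEntry D i j v) = cellProb p i j v *
      ∏ x ∈ Finset.univ.erase (i, j), cellProb p x.1 x.2 (D x.1 x.2) := by
  rw [indep, ← Fintype.prod_prod_type' (f := fun i' j' =>
      cellProb p i' j' (setEntry D i j v i' j')),
    ← Finset.mul_prod_erase Finset.univ _ (Finset.mem_univ (i, j))]
  congr 1
  · simp [setEntry]
  · refine Finset.prod_congr rfl fun x hx => ?_
    simp [setEntry, Finset.ne_of_mem_erase hx]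

lemma cellProb_true_of_hasWeights {p : Dataset n m → ℝ} {w : Tile n m → ℝ}
    (hp : p ∈ stdSimplex ℝ (Dataset n m)) (hind : p = indep p) (hw : HasWeights 𝒯 α p w)
    (i : Fin n) (j : Fin m) (h0 : cellProb p i j true ≠ 0) (h1 : cellProb p i j true ≠ 1) :
    cellProb p i j true = Real.exp (∑ T ∈ covering 𝒯 i j, w T) /
      (Real.exp (∑ T ∈ covering 𝒯 i j, w T) + 1) := by
  have hadd : cellProb p i j true + cellProb p i j false = 1 := by
    simpa using sum_cellProb hp i j
  have hf0 : cellProb p i j false ≠ 0 := fun h => h1 (by linarith)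
  obtain ⟨D, hD⟩ : ∃ D, p D ≠ 0 := by
    by_contra! h
    simpa [h] using hp.2
  set r := ∏ x ∈ Finset.univ.erase (i, j), cellProb p x.1 x.2 (D x.1 x.2)
  have hr : r ≠ 0 := Finset.prod_ne_zero_iff.mpr fun x _ =>
    (cellProb_pos_of_pos hp ((hp.1 D).lt_of_ne' hD) x.1 x.2).ne'
  have hset (v : Bool) : p (setEntry D i j v) = cellProb p i j v * r := by
    conv_lhs => rw [hind]
    exact indep_setEntry p D i j v
  obtain ⟨c, hc, hform⟩ := hw
  -- By the product form both switched datasets have nonzero probability, so neither is null and the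
  -- exponential form applies to both.
  have hexp (v : Bool) (hv : cellProb p i j v ≠ 0) := (hform (setEntry D i j v)).1 fun hmem =>
    mul_ne_zero hv hr (hset v ▸ (hform _).2 hmem)
  have ht := hexp true h0
  rw [weight_setEntry, Real.exp_add, ← mul_assoc, ← hexp false hf0, hset, hset] at ht
  set e := Real.exp (∑ T ∈ covering 𝒯 i j, w T)
  have he : 0 < e := Real.exp_pos _
  have hratio : cellProb p i j true = cellProb p i j false * e :=
    mul_right_cancel₀ hr (by rw [ht]; ring)
  rw [eq_div_iff (by positivity)]
  linear_combination hratio + e * hadd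

end TileModel

theorem mainTheorem2 (n m : ℕ) (𝒯 : Finset (TileModel.Tile n m)) (α : TileModel.Tile n m → ℝ)
    (hcons : (TileModel.candidates 𝒯 α).Nonempty) :
    (∃! p : TileModel.Dataset n m → ℝ, TileModel.IsMaxEnt 𝒯 α p) ∧
    ∀ p : TileModel.Dataset n m → ℝ, TileModel.IsMaxEnt 𝒯 α p →
      (∀ D : TileModel.Dataset n m, p D = ∏ i, ∏ j, TileModel.cellProb p i j (D i j)) ∧
      (∃ w : TileModel.Tile n m → ℝ, TileModel.HasWeights 𝒯 α p w) ∧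
      ∀ w : TileModel.Tile n m → ℝ, TileModel.HasWeights 𝒯 α p w →
        ∀ (i : Fin n) (j : Fin m),
          TileModel.cellProb p i j true =
              Real.exp (∑ T ∈ TileModel.covering 𝒯 i j, w T) /
                (Real.exp (∑ T ∈ TileModel.covering 𝒯 i j, w T) + 1) ∨
            TileModel.cellProb p i j true = 0 ∨ TileModel.cellProb p i j true = 1 := by
  refine ⟨TileModel.existsUnique_isMaxEnt hcons, fun p hp =>
    ⟨congrFun hp.eq_indep, hp.exists_hasWeights, fun w hw i j => ?_⟩⟩
  by_cases h0 : TileModel.cellProb p i j true = 0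
  · exact Or.inr (Or.inl h0)
  by_cases h1 : TileModel.cellProb p i j true = 1
  · exact Or.inr (Or.inr h1)
  exact Or.inl (TileModel.cellProb_true_of_hasWeights hp.1.1 hp.eq_indep hw i j h0 h1)
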